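/- Consider lambda-terms up to renaming of bound variables, i.e. plane unary-binary trees (unary nodes are abstractions, binary nodes are applications, leaves are variables) in which every leaf may carry one pointer from a unary node that is an ancestor of it (the abstraction binding it). The term is closed if every leaf carries such a pointer. The size of a term is its total number of nodes: $|x|=1$, $|\lambda x.T|=1+|T|$, $|(S*T)|=1+|S|+|T|$. For an integer $p\ge 1$, a $BCI(p)$-term is a closed lambda-term in which every unary node binds exactly $p$ leaves. Let $g^{(p)}_m$ be the number of $BCI(p)$-terms of size $m$. Put \[ \beta_p=\frac{(4p+2)^p}{p!},\qquad \gamma_p=\frac{p(p-2)}{2p+1},\qquad B_p=C_{p-1}\prod_{k=1}^{p}\frac{1}{\Gamma\left(1+\frac{2(p-k)-1}{2p+1}\right)}, \] where $C_{p-1}=\frac1p\binom{2p-2}{p-1}$ is the Catalan number. Theorem. There are constants $a_p>0$ $(p\ge 2)$ such that, with $A_p=a_pB_p$, for every fixed $p\ge 2$ \[ g^{(p)}_{(2p+1)n-1}\sim A_p\,\beta_p^{\,n-1}\,n^{\gamma_p}\,\big((n-1)!\big)^p\qquad\text{as } n\to\infty, \] and \[ a_p=1+O\left(\frac{1}{p\,e^{p}}\right)\qquad\text{as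 } p\to\infty. \] -/

import Mathlib

open Filter Asymptotics
open scoped Nat

/-- Lambda-terms up to renaming of bound variables, as enriched Motzkin trees: `app` is a binary
node, `lam` a unary node, and a leaf `var i` carries a pointer from the `(i + 1)`-st unary node met
on the way up from the leaf to the root (de Bruijn index); if there are at most `i` unary nodes
above the leaf, then the leaf is free. The order of the two children of a binary node matters. -/
inductive LambdaTerm : Type
  | var (i : ℕ) : LambdaTerm
  | app (s t : LambdaTerm) : LambdaTerm
  | lam (t : LambdaTerm) : LambdaTerm

namespace LambdaTerm

/-- The size: the total number of nodes (leaves, unary nodes and binary nodes). -/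
def size : LambdaTerm → ℕ
  | var _ => 1
  | app s t => 1 + size s + size t
  | lam t => 1 + size t

/-- Every leaf of the term is bound, once the term is placed below `k` further unary nodes. -/
def ClosedBelow : ℕ → LambdaTerm → Prop
  | k, var i => i < k
  | k, app s t => ClosedBelow k s ∧ ClosedBelow k t
  | k, lam t => ClosedBelow (k + 1) t

/-- A closed term: every leaf is bound by a unary node of the term. -/
def Closed (t : LambdaTerm) : Prop := ClosedBelow 0 t

/-- The number of leaves that refer to the `(k + 1)`-st unary node above the root of the given
term. In particular `occ 0 t` is the number of leaves bound by the root of `lam t`. -/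
def occ : ℕ → LambdaTerm → ℕ
  | k, var i => if i = k then 1 else 0
  | k, app s t => occ k s + occ k t
  | k, lam t => occ (k + 1) t

/-- Every unary node of the term binds exactly `p` leaves. -/
def EachBinds (p : ℕ) : LambdaTerm → Prop
  | var _ => True
  | app s t => EachBinds p s ∧ EachBinds p t
  | lam t => occ 0 t = p ∧ EachBinds p t

/-- `BCI(p)`: closed lambda-terms in which each unary node has exactly `p` pointers. -/
def IsBCI (p : ℕ) (t : LambdaTerm) : Prop := Closed t ∧ EachBinds p t

theorem size_pos (t : LambdaTerm) : 0 < size t := by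
  cases t <;> simp only [size] <;> omega

theorem finite_closedBelow_size_le (m : ℕ) :
    ∀ k : ℕ, {t : LambdaTerm | ClosedBelow k t ∧ size t ≤ m}.Finite := by
  induction m with
  | zero =>
    intro k
    convert Set.finite_empty (α := LambdaTerm)
    ext t
    have := size_pos t
    simp only [Set.mem_ofPred_eq, Set.mem_empty_iff_false, iff_false]
    omega
  | succ m ih =>
    intro k
    refine (((Set.finite_Iio k).image var).union
      ((((ih k).prod (ih k)).image fun q => app q.1 q.2).union ((ih (k + 1)).image lam))).subset ?_
    rintro (i | ⟨s, t⟩ | t) ⟨hc, hs⟩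
    · exact Or.inl ⟨i, hc, rfl⟩
    · simp only [size] at hs
      have h1 := size_pos s
      have h2 := size_pos t
      have h3 : size s ≤ m := by omega
      have h4 : size t ≤ m := by omega
      exact Or.inr (Or.inl ⟨(s, t), ⟨⟨hc.1, h3⟩, ⟨hc.2, h4⟩⟩, rfl⟩)
    · simp only [size] at hs
      exact Or.inr (Or.inr ⟨t, ⟨hc, by omega⟩, rfl⟩)

/-- There are finitely many `BCI(p)`-terms of each size, so that counting them makes sense. -/
theorem finite_isBCI (p m : ℕ) : {t : LambdaTerm | IsBCI p t ∧ size t = m}.Finite :=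
  (finite_closedBelow_size_le m 0).subset fun _ ht => ⟨ht.1.1, ht.2.le⟩

end LambdaTerm

/-- The number of `BCI(p)`-terms of size `m`. -/
noncomputable def bciCount (p m : ℕ) : ℕ :=
  {t : LambdaTerm | t.IsBCI p ∧ t.size = m}.ncard

/-- `β_p = (4p+2)^p / p!`. -/
noncomputable def bciBeta (p : ℕ) : ℝ := (4 * (p : ℝ) + 2) ^ p / (p ! : ℝ)

/-- `γ_p = p(p-2) / (2p+1)`. -/
noncomputable def bciGamma (p : ℕ) : ℝ := (p : ℝ) * ((p : ℝ) - 2) / (2 * (p : ℝ) + 1)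

/-- `B_p = C_{p-1} ∏_{k=1}^p 1 / Γ(1 + (2(p-k)-1)/(2p+1))`, where `C_{p-1}` is the Catalan number
(used for `p ≥ 1` only). -/
noncomputable def bciB (p : ℕ) : ℝ :=
  (catalan (p - 1) : ℝ) *
    ∏ k ∈ Finset.Icc 1 p,
      1 / Real.Gamma (1 + (2 * ((p : ℝ) - (k : ℝ)) - 1) / (2 * (p : ℝ) + 1))

/-!
A closed term is an application of two closed terms or an abstraction over a term with `p` free
leaves. A free leaf of the body can be deleted together with the binary node above it, and a term of
size `m` has `2 * m` places where a leaf can be inserted back. This double counting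
(`LambdaTerm.succ_mul_card_openTerms`, in the manner of Rémy's algorithm for binary trees) shows
that a closed term with `k ≥ 1` unary nodes, hence of size `m = (2 * p + 1) * k - 1`, gives rise to
`φ k = 2 ^ p * m * (m + 2) * ... * (m + 2 * p - 2) / p !` abstractions. So the number `g n` of
terms with `n` unary nodes satisfies `g 1 = catalan (p - 1)` and
`g (n + 1) = ∑ g i * g (n + 1 - i) + φ n * g n` (`bciCount_recurrence`).

Without the convolution, the solution would be `catalan (p - 1) * φ 1 * ... * φ (n - 1)`. Each of
the `p` linear factors of `φ` turns into a Gamma value by Euler's limit, which yields the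
asymptotics with constant `bciB p` (`prod_bciInsertions_isEquivalent`). The quotient of `g n` by
this product increases with `n`. Since `φ k ≥ k ^ 2 * φ 1`, the convolution adds at most a constant
times `ε / n ^ 2` to it, where `ε = catalan (p - 1) / φ 1 = 1 / (4 ^ p * (2 * p - 1))`; so the quotient
converges to a number `a` with `1 ≤ a ≤ 1 + 24 * ε` (`exists_tendsto_div_prod`), and `exp 1 < 4`.
-/

/-! ### Inserting and deleting a leaf -/

namespace LambdaTerm

/-- All ways to insert one further leaf pointing to the unary node `k + 1` levels above the root of
`t`: on the edge above any node of `t` a new binary node is put, with the new leaf as its left or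
as its right child. The multiplicity of a term is the number of insertions that produce it. -/
def insertions : ℕ → LambdaTerm → Multiset LambdaTerm
  | k, var i => {app (var k) (var i)} + {app (var i) (var k)}
  | k, app s t => {app (var k) (app s t)} + {app (app s t) (var k)} +
      ((insertions k s).map (fun r => app r t) + (insertions k t).map (fun r => app s r))
  | k, lam t => {app (var k) (lam t)} + {app (lam t) (var k)} + (insertions (k + 1) t).map lam

open Classical in
/-- All ways to delete one leaf pointing to the unary node `k + 1` levels above the root of the
term, together with the binary node right above that leaf. Leaves whose parent is not a binary node
cannot be deleted. -/
noncomputable def deletions : ℕ → LambdaTerm → Multiset LambdaTerm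
  | _, var _ => 0
  | k, app s t => ((if s = var k then {t} else 0) + (if t = var k then {s} else 0)) +
      ((deletions k s).map (fun r => app r t) + (deletions k t).map (fun r => app s r))
  | k, lam t => (deletions (k + 1) t).map lam

theorem card_insertions (t : LambdaTerm) : ∀ k, (insertions k t).card = 2 * size t := by
  induction t with
  | var i => intro k; simp [insertions, size]
  | app s t hs ht => intro k; simp [insertions, size, hs, ht]; ring
  | lam t ht => intro k; simp [insertions, size, ht]; ring

open Classical in
theorem count_map_app_left (m : Multiset LambdaTerm) (a b t : LambdaTerm) :
    (m.map (fun r => app r t)).count (app a b) = if b = t then m.count a else 0 := by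
  split_ifs with h
  · subst h
    exact Multiset.count_map_eq_count' (fun r => app r b) m (fun x y h => by simpa using h) a
  · rw [Multiset.count_eq_zero]
    simp only [Multiset.mem_map, app.injEq, not_exists, not_and]
    exact fun _ _ _ h' => h h'.symm

open Classical in
theorem count_map_app_right (m : Multiset LambdaTerm) (a b s : LambdaTerm) :
    (m.map (fun r => app s r)).count (app a b) = if a = s then m.count b else 0 := by
  split_ifs with h
  · subst h
    exact Multiset.count_map_eq_count' (fun r => app a r) m (fun x y h => by simpa using h) b
  · rw [Multiset.count_eq_zero]
    simp only [Multiset.mem_map, app.injEq, not_exists, not_and]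
    exact fun _ _ h' => absurd h'.symm h

open Classical in
theorem count_map_lam (m : Multiset LambdaTerm) (t : LambdaTerm) :
    (m.map lam).count (lam t) = m.count t :=
  Multiset.count_map_eq_count' lam m (fun x y h => by simpa using h) t

open Classical in
/-- Inserting and deleting are mutually inverse, with multiplicities. -/
theorem count_insertions_eq_count_deletions (t' : LambdaTerm) :
    ∀ (k : ℕ) (t : LambdaTerm), (insertions k t).count t' = (deletions k t').count t := by
  induction t' with
  | var i =>
    intro k t
    rw [Multiset.count_eq_zero.2]
    · simp [deletions]
    · cases t <;> simp [insertions]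
  | app a b ha hb =>
    intro k t
    have key : ∀ t : LambdaTerm, (({app (var k) t} + {app t (var k)} :
        Multiset LambdaTerm).count (app a b)) =
        ((if a = var k then {b} else 0) + (if b = var k then {a} else 0) :
          Multiset LambdaTerm).count t := by
      intro t
      simp only [Multiset.count_add, Multiset.count_singleton, app.injEq]
      congr 1
      · by_cases h : a = var k <;> simp [h, Multiset.count_singleton, eq_comm]
      · by_cases h : b = var k <;> simp [h, Multiset.count_singleton, eq_comm]
    cases t with
    | var i =>
      simp only [insertions, key, deletions]
      rw [Multiset.count_add _ (_ + _) (_ + _), Nat.left_eq_add, Multiset.count_eq_zero]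
      simp
    | app c d =>
      simp only [insertions, deletions]
      rw [Multiset.count_add, key, Multiset.count_add _ (_ + _) (_ + _)]
      simp only [Multiset.count_add _ (Multiset.map _ _), count_map_app_left,
        count_map_app_right, ha, hb, eq_comm (a := b), eq_comm (a := a)]
    | lam t =>
      simp only [insertions, deletions]
      rw [Multiset.count_add, key, Multiset.count_add _ (_ + _) (_ + _), Nat.add_left_cancel_iff,
        Multiset.count_eq_zero.2, Multiset.count_eq_zero.2] <;> simp
  | lam u hu =>
    intro k t
    cases t with
    | lam t => simp [insertions, deletions, count_map_lam, hu]
    | _ =>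
      simp only [insertions, deletions]
      rw [Multiset.count_eq_zero.2, Multiset.count_eq_zero.2] <;> simp

theorem mem_insertions_iff_mem_deletions (k : ℕ) (t t' : LambdaTerm) :
    t' ∈ insertions k t ↔ t ∈ deletions k t' := by
  classical
  rw [← Multiset.count_pos, ← Multiset.count_pos, count_insertions_eq_count_deletions]

/-- Effect of one insertion on size, scoping and binding. -/
theorem of_mem_insertions (t : LambdaTerm) : ∀ (k : ℕ) (t' : LambdaTerm), t' ∈ insertions k t →
    size t' = size t + 2 ∧ (∀ j, occ j t' = occ j t + if j = k then 1 else 0) ∧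
      (∀ j, k < j → (ClosedBelow j t' ↔ ClosedBelow j t)) ∧
      ∀ p, EachBinds p t' ↔ EachBinds p t := by
  have key : ∀ (k : ℕ) (t t' : LambdaTerm),
      t' ∈ ({app (var k) t} + {app t (var k)} : Multiset LambdaTerm) →
      size t' = size t + 2 ∧ (∀ j, occ j t' = occ j t + if j = k then 1 else 0) ∧
      (∀ j, k < j → (ClosedBelow j t' ↔ ClosedBelow j t)) ∧
      ∀ p, EachBinds p t' ↔ EachBinds p t := by
    intro k t t' h
    simp only [Multiset.mem_add, Multiset.mem_singleton] at h
    rcases h with rfl | rfl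
    · refine ⟨by simp only [size]; ring, fun j => ?_, fun j hj => ?_, fun p => ?_⟩
      · simp only [occ, eq_comm (a := k)]; ring
      · simp [ClosedBelow, hj]
      · simp [EachBinds]
    · refine ⟨by simp only [size]; ring, fun j => ?_, fun j hj => ?_, fun p => ?_⟩
      · simp only [occ, eq_comm (a := k)]
      · simp [ClosedBelow, hj]
      · simp [EachBinds]
  induction t with
  | var i => exact fun k t' h => key k _ _ h
  | app s t hs ht =>
    intro k t' h
    rw [insertions, Multiset.mem_add] at h
    rcases h with h | h
    · exact key k _ _ h
    · simp only [Multiset.mem_add, Multiset.mem_map] at h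
      rcases h with ⟨r, hr, rfl⟩ | ⟨r, hr, rfl⟩
      · obtain ⟨h1, h2, h3, h4⟩ := hs k r hr
        refine ⟨by simp only [size, h1]; ring, fun j => by simp only [occ, h2]; ring,
          fun j hj => by simp only [ClosedBelow, h3 j hj], fun p => by simp only [EachBinds, h4]⟩
      · obtain ⟨h1, h2, h3, h4⟩ := ht k r hr
        refine ⟨by simp only [size, h1]; ring, fun j => by simp only [occ, h2]; ring,
          fun j hj => by simp only [ClosedBelow, h3 j hj], fun p => by simp only [EachBinds, h4]⟩
  | lam t ht =>
    intro k t' h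
    rw [insertions, Multiset.mem_add] at h
    rcases h with h | h
    · exact key k _ _ h
    · simp only [Multiset.mem_map] at h
      obtain ⟨r, hr, rfl⟩ := h
      obtain ⟨h1, h2, h3, h4⟩ := ht (k + 1) r hr
      refine ⟨by simp only [size, h1]; ring, fun j => by simp [occ, h2],
        fun j hj => h3 (j + 1) (by omega), fun p => by simp [EachBinds, h4, h2]⟩

open Classical in
/-- Every leaf can be deleted: its parent is binary, because the body of an abstraction contains a
leaf bound by it, hence is not a single leaf pointing elsewhere. -/
theorem card_deletions {p : ℕ} (hp : 1 ≤ p) (t : LambdaTerm) :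
    ∀ k, EachBinds p t → t ≠ var k → (deletions k t).card = occ k t := by
  induction t with
  | var i =>
    intro k _ h
    have : i ≠ k := fun h' => h (by rw [h'])
    simp [deletions, occ, this]
  | app s t hs ht =>
    intro k hb _
    have hs' : (if s = var k then {t} else 0 : Multiset LambdaTerm).card + (deletions k s).card
        = occ k s := by
      split_ifs with h
      · simp [h, deletions, occ]
      · simp [hs k hb.1 h]
    have ht' : (if t = var k then {s} else 0 : Multiset LambdaTerm).card + (deletions k t).card
        = occ k t := by
      split_ifs with h
      · simp [h, deletions, occ]
      · simp [ht k hb.2 h]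
    simp only [deletions, occ, Multiset.card_add, Multiset.card_map, ← hs', ← ht']
    ring
  | lam t ht =>
    intro k hb _
    rw [deletions, Multiset.card_map, occ, ht (k + 1) hb.2]
    rintro rfl
    have := hb.1
    simp [occ] at this
    omega

/-! ### Counting terms with marked free leaves -/

/-- Terms of size `m` in which every unary node binds `p` leaves and exactly `q` leaves are free,
all of them pointing to one further unary node above the root. -/
noncomputable def openTerms (p q m : ℕ) : Finset LambdaTerm :=
  ((finite_closedBelow_size_le m 1).subset
    (t := {t | ClosedBelow 1 t ∧ EachBinds p t ∧ occ 0 t = q ∧ size t = m})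
    fun _ h => ⟨h.1, h.2.2.2.le⟩).toFinset

theorem mem_openTerms {p q m : ℕ} {t : LambdaTerm} : t ∈ openTerms p q m ↔
    ClosedBelow 1 t ∧ EachBinds p t ∧ occ 0 t = q ∧ size t = m := by
  simp [openTerms]

/-- Double counting of the pairs formed by a term and one of its free leaves: deleting the leaf
gives a term of size `m`, into which it can be inserted back in `2 * m` ways. -/
theorem succ_mul_card_openTerms {p : ℕ} (hp : 1 ≤ p) (q m : ℕ) (hm : 1 ≤ m) :
    (q + 1) * (openTerms p (q + 1) (m + 2)).card = 2 * m * (openTerms p q m).card := by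
  classical
  have h1 : ∑ t ∈ openTerms p q m, ∑ t' ∈ openTerms p (q + 1) (m + 2), (insertions 0 t).count t' =
      ∑ t ∈ openTerms p q m, 2 * m := by
    refine Finset.sum_congr rfl fun t ht => ?_
    rw [mem_openTerms] at ht
    rw [Multiset.sum_count_eq_card, card_insertions, ht.2.2.2]
    intro t' ht'
    obtain ⟨a, b, c, d⟩ := of_mem_insertions t 0 t' ht'
    rw [mem_openTerms, a, b, c 1 one_pos, d]
    simp [ht]
  have h2 : ∑ t' ∈ openTerms p (q + 1) (m + 2), ∑ t ∈ openTerms p q m, (insertions 0 t).count t' =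
      ∑ t' ∈ openTerms p (q + 1) (m + 2), (q + 1) := by
    refine Finset.sum_congr rfl fun t' ht' => ?_
    rw [mem_openTerms] at ht'
    simp only [count_insertions_eq_count_deletions]
    rw [Multiset.sum_count_eq_card, card_deletions hp t' 0 ht'.2.1, ht'.2.2.1]
    · rintro rfl
      have := ht'.2.2.2
      simp only [size] at this
      omega
    · intro t ht
      rw [← mem_insertions_iff_mem_deletions] at ht
      obtain ⟨a, b, c, d⟩ := of_mem_insertions t 0 t' ht
      rw [a, b, c 1 one_pos, d] at ht'
      rw [mem_openTerms]
      simpa using ht'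
  rw [Finset.sum_comm, h2] at h1
  simpa [mul_comm] using h1

theorem factorial_mul_card_openTerms {p : ℕ} (hp : 1 ≤ p) (m : ℕ) (hm : 1 ≤ m) (q : ℕ) :
    q ! * (openTerms p q (m + 2 * q)).card =
      (∏ j ∈ Finset.range q, 2 * (m + 2 * j)) * (openTerms p 0 m).card := by
  induction q with
  | zero => simp
  | succ q ih =>
    have h := succ_mul_card_openTerms hp q (m + 2 * q) (by omega)
    rw [Finset.prod_range_succ, mul_right_comm, ← ih, Nat.factorial_succ,
      show m + 2 * (q + 1) = m + 2 * q + 2 by ring]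
    linear_combination (q ! : ℕ) * h

/-- The open terms without abstractions are the binary trees. -/
theorem card_openTerms_eq_catalan {p : ℕ} (hp : 1 ≤ p) (q : ℕ) :
    (openTerms p (q + 1) (2 * q + 1)).card = catalan q := by
  induction q with
  | zero =>
    rw [catalan_zero, Finset.card_eq_one]
    refine ⟨var 0, ?_⟩
    ext t
    rw [mem_openTerms, Finset.mem_singleton]
    constructor
    · rintro ⟨h1, -, -, h2⟩
      cases t with
      | var i =>
        simp only [ClosedBelow] at h1
        rw [Nat.lt_one_iff.1 h1]
      | app s t =>
        have := size_pos s
        have := size_pos t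
        simp only [size] at h2
        omega
      | lam t =>
        have := size_pos t
        simp only [size] at h2
        omega
    · rintro rfl
      simp [ClosedBelow, EachBinds, occ, size]
  | succ q ih =>
    have h := succ_mul_card_openTerms hp (q + 1) (2 * q + 1) (by omega)
    have h1 := Nat.succ_mul_centralBinom_succ q
    rw [← succ_mul_catalan_eq_centralBinom, ← succ_mul_catalan_eq_centralBinom] at h1
    rw [ih] at h
    have h2 : (q + 1 + 1) * (openTerms p (q + 1 + 1) (2 * q + 1 + 2)).card =
        (q + 1 + 1) * catalan (q + 1) := by
      rw [h]
      refine Nat.eq_of_mul_eq_mul_left (Nat.succ_pos q) ?_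
      simp only [Nat.succ_eq_add_one] at h1 ⊢
      linear_combination -h1
    exact Nat.eq_of_mul_eq_mul_left (Nat.succ_pos _) h2

/-! ### The recurrence for the number of terms -/

theorem closedBelow_succ_and_occ_eq_zero (t : LambdaTerm) :
    ∀ k, ClosedBelow (k + 1) t ∧ occ k t = 0 ↔ ClosedBelow k t := by
  induction t with
  | var i =>
    intro k
    simp only [ClosedBelow, occ, ite_eq_right_iff, one_ne_zero, imp_false]
    omega
  | app s t hs ht =>
    intro k
    simp only [ClosedBelow, occ, ← hs k, ← ht k, Nat.add_eq_zero_iff]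
    tauto
  | lam t ht => exact fun k => ht (k + 1)

theorem card_openTerms_zero (p m : ℕ) : (openTerms p 0 m).card = bciCount p m := by
  rw [bciCount, ← Set.ncard_coe_finset]
  congr 1
  ext t
  simp only [Finset.mem_coe, mem_openTerms, Set.mem_ofPred_eq, IsBCI, Closed,
    ← closedBelow_succ_and_occ_eq_zero t 0]
  tauto

/-- The size is determined by the numbers of abstractions and of free leaves. -/
theorem exists_size_add_one_eq (p : ℕ) (t : LambdaTerm) : ∀ k, ClosedBelow k t → EachBinds p t →
    ∃ n, size t + 1 = (2 * p + 1) * n + 2 * ∑ i ∈ Finset.range k, occ i t := by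
  induction t with
  | var i =>
    intro k hk _
    refine ⟨0, ?_⟩
    simp only [occ, Finset.sum_ite_eq, Finset.mem_range]
    simp only [ClosedBelow] at hk
    simp [size, hk]
  | app s t hs ht =>
    intro k hk hb
    obtain ⟨a, ha⟩ := hs k hk.1 hb.1
    obtain ⟨b, hb⟩ := ht k hk.2 hb.2
    refine ⟨a + b, ?_⟩
    simp only [size, occ, Finset.sum_add_distrib]
    linear_combination ha + hb
  | lam t ht =>
    intro k hk hb
    obtain ⟨a, ha⟩ := ht (k + 1) hk hb.2
    refine ⟨a + 1, ?_⟩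
    rw [Finset.sum_range_succ', hb.1] at ha
    simp only [size, occ]
    linear_combination ha

theorem bciCount_eq_zero {p m : ℕ} (h : ¬ (2 * p + 1) ∣ m + 1) : bciCount p m = 0 := by
  rw [bciCount, Set.ncard_eq_zero (finite_isBCI p m), Set.eq_empty_iff_forall_notMem]
  rintro t ⟨⟨hc, hb⟩, rfl⟩
  obtain ⟨n, hn⟩ := exists_size_add_one_eq p t 0 hc hb
  exact h ⟨n, by simpa using hn⟩

/-- A closed term is an application of closed terms or an abstraction. -/
theorem bciCount_succ (p m : ℕ) : bciCount p (m + 1) =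
    ∑ ij ∈ Finset.HasAntidiagonal.antidiagonal m, bciCount p ij.1 * bciCount p ij.2 +
      (openTerms p p m).card := by
  classical
  simp only [← card_openTerms_zero]
  have hU : openTerms p 0 (m + 1) = ((Finset.HasAntidiagonal.antidiagonal m).biUnion fun ij =>
      (openTerms p 0 ij.1 ×ˢ openTerms p 0 ij.2).image fun st => app st.1 st.2) ∪
      (openTerms p p m).image lam := by
    ext t
    have h0 := fun t => closedBelow_succ_and_occ_eq_zero t 0
    have h1 : ∀ m t, t ∈ openTerms p 0 m ↔ ClosedBelow 0 t ∧ EachBinds p t ∧ size t = m := by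
      intro m t
      rw [mem_openTerms, ← h0]
      tauto
    simp only [Finset.mem_union, Finset.mem_biUnion, Finset.mem_image, Finset.mem_product, h1,
      mem_openTerms (q := p), Finset.HasAntidiagonal.mem_antidiagonal, Prod.exists]
    constructor
    · rintro ⟨hc, hb, hs⟩
      cases t with
      | var i => exact absurd hc (Nat.not_lt_zero i)
      | app s t =>
        simp only [size] at hs
        exact Or.inl ⟨size s, size t, by omega, s, t, ⟨⟨hc.1, hb.1, rfl⟩, ⟨hc.2, hb.2, rfl⟩⟩, rfl⟩
      | lam t =>
        simp only [size] at hs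
        exact Or.inr ⟨t, ⟨hc, hb.2, hb.1, by omega⟩, rfl⟩
    · rintro (⟨a, b, hab, s, t, ⟨⟨hc, hb, hs⟩, ⟨hc', hb', hs'⟩⟩, rfl⟩ | ⟨t, ⟨hc, hb, ho, hs⟩, rfl⟩)
      · exact ⟨⟨hc, hc'⟩, ⟨hb, hb'⟩, by simp only [size]; omega⟩
      · exact ⟨hc, ⟨ho, hb⟩, by simp only [size]; omega⟩
  rw [hU, Finset.card_union_of_disjoint, Finset.card_biUnion,
    Finset.card_image_of_injective _ fun x y h => by simpa using h]
  · congr 1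
    refine Finset.sum_congr rfl fun ij _ => ?_
    rw [Finset.card_image_of_injective, Finset.card_product]
    intro x y h
    simpa [Prod.ext_iff] using h
  · intro x _ y _ hxy
    rw [Function.onFun, Finset.disjoint_left]
    intro t ht ht'
    simp only [Finset.mem_image, Finset.mem_product, mem_openTerms, Prod.exists] at ht ht'
    obtain ⟨a, b, h, rfl⟩ := ht
    obtain ⟨a', b', h', heq⟩ := ht'
    obtain ⟨rfl, rfl⟩ := app.inj heq
    exact hxy (Prod.ext (h.1.2.2.2.symm.trans h'.1.2.2.2) (h.2.2.2.2.symm.trans h'.2.2.2.2))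
  · rw [Finset.disjoint_left]
    intro t ht ht'
    simp only [Finset.mem_biUnion, Finset.mem_image] at ht ht'
    obtain ⟨_, _, _, _, rfl⟩ := ht
    obtain ⟨_, _, h⟩ := ht'
    cases h

/-- The terms with `n + 1` abstractions have size `(2 * p + 1) * n + 2 * p`, and only such sizes
contribute to the convolution. -/
theorem sum_antidiagonal_bciCount (p n : ℕ) :
    ∑ ij ∈ Finset.HasAntidiagonal.antidiagonal ((2 * p + 1) * n + 4 * p),
      bciCount p ij.1 * bciCount p ij.2 = ∑ i ∈ Finset.range (n + 1),
        bciCount p ((2 * p + 1) * i + 2 * p) * bciCount p ((2 * p + 1) * (n - i) + 2 * p) := by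
  symm
  refine Finset.sum_of_injOn
    (fun i => ((2 * p + 1) * i + 2 * p, (2 * p + 1) * (n - i) + 2 * p)) ?_ ?_ ?_ ?_
  · intro i _ j _ h
    have h' : (2 * p + 1) * i = (2 * p + 1) * j := by
      have := congrArg Prod.fst h
      simp only at this
      omega
    exact Nat.eq_of_mul_eq_mul_left (Nat.succ_pos _) h'
  · intro i hi
    have hi' : i ≤ n := by simpa [Nat.lt_succ_iff] using hi
    obtain ⟨j, rfl⟩ := Nat.exists_eq_add_of_le hi'
    simp only [Finset.mem_coe, Finset.HasAntidiagonal.mem_antidiagonal, Nat.add_sub_cancel_left]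
    ring
  · rintro ⟨x, y⟩ hxy hne
    rw [Finset.HasAntidiagonal.mem_antidiagonal] at hxy
    by_contra h0
    simp only [mul_eq_zero, not_or] at h0 hxy
    obtain ⟨a, ha⟩ := not_not.1 fun h => h0.1 (bciCount_eq_zero h)
    obtain ⟨b, hb⟩ := not_not.1 fun h => h0.2 (bciCount_eq_zero h)
    have hab : (2 * p + 1) * (a + b) = (2 * p + 1) * (n + 2) := by
      linear_combination hxy - ha - hb
    have hab' : a + b = n + 2 := Nat.eq_of_mul_eq_mul_left (Nat.succ_pos _) hab
    have ha0 : a ≠ 0 := by rintro rfl; simp at ha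
    have hb0 : b ≠ 0 := by rintro rfl; simp at hb
    obtain ⟨a, rfl⟩ := Nat.exists_eq_succ_of_ne_zero ha0
    obtain ⟨b, rfl⟩ := Nat.exists_eq_succ_of_ne_zero hb0
    refine hne ⟨a, ?_, ?_⟩
    · simp only [Finset.coe_range, Set.mem_Iio]
      omega
    · have : n - a = b := by omega
      simp only [this, Prod.mk.injEq, Nat.succ_eq_add_one] at ha hb ⊢
      constructor <;> linarith
  · intro i _
    rfl

end LambdaTerm

open LambdaTerm

/-- The number of ways to insert `p` further leaves, bound by a new unary node at the root, into a
closed term with `k ≥ 1` unary nodes in which each of them binds `p` leaves. -/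
noncomputable def bciInsertions (p k : ℕ) : ℝ :=
  (∏ j ∈ Finset.range p, 2 * ((2 * (p : ℝ) + 1) * k - 1 + 2 * j)) / p !

/-- The terms with a single unary node. -/
theorem bciCount_two_mul {p : ℕ} (hp : 1 ≤ p) : bciCount p (2 * p) = catalan (p - 1) := by
  obtain ⟨q, rfl⟩ := Nat.exists_eq_succ_of_ne_zero (Nat.one_le_iff_ne_zero.1 hp)
  have h := bciCount_succ (q + 1) (2 * q + 1)
  rw [card_openTerms_eq_catalan hp, Finset.sum_eq_zero, zero_add] at h
  · exact h
  · rintro ⟨x, y⟩ hxy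
    rw [Finset.HasAntidiagonal.mem_antidiagonal] at hxy
    simp only at hxy
    rw [bciCount_eq_zero (m := x), zero_mul]
    intro hd
    have := Nat.le_of_dvd (Nat.succ_pos _) hd
    omega

/-- The recurrence by the number of unary nodes: the size `(2 * p + 1) * n + 2 * p` belongs to
`n + 1` unary nodes. -/
theorem bciCount_recurrence {p : ℕ} (hp : 1 ≤ p) (n : ℕ) :
    (bciCount p ((2 * p + 1) * (n + 1) + 2 * p) : ℝ) =
      ∑ i ∈ Finset.range (n + 1), (bciCount p ((2 * p + 1) * i + 2 * p) : ℝ) *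
        bciCount p ((2 * p + 1) * (n - i) + 2 * p) +
      bciInsertions p (n + 1) * bciCount p ((2 * p + 1) * n + 2 * p) := by
  have h1 := factorial_mul_card_openTerms hp ((2 * p + 1) * n + 2 * p) (by omega) p
  rw [card_openTerms_zero] at h1
  have h2 := bciCount_succ p ((2 * p + 1) * n + 4 * p)
  rw [sum_antidiagonal_bciCount] at h2
  rw [show (2 * p + 1) * n + 2 * p + 2 * p = (2 * p + 1) * n + 4 * p by ring] at h1
  rw [show (2 * p + 1) * (n + 1) + 2 * p = (2 * p + 1) * n + 4 * p + 1 by ring, h2]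
  push_cast
  congr 1
  have hp0 : (p ! : ℝ) ≠ 0 := by positivity
  rw [bciInsertions, div_mul_eq_mul_div, eq_div_iff hp0, mul_comm]
  have h3 := congrArg (Nat.cast : ℕ → ℝ) h1
  push_cast at h3
  rw [h3]
  congr 1
  refine Finset.prod_congr rfl fun j _ => ?_
  push_cast
  ring

/-! ### Quadratic recurrences dominated by their linear term -/

section Recurrence

variable {f : ℕ → ℝ}

/-- The products of an increasing sequence are log-convex, so products with a fixed sum of lengths
are largest at the ends of the range. -/
theorem prod_mul_prod_le (hf : Monotone f) (hf0 : ∀ n, 0 < f n) (a b : ℕ) :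
    (∏ i ∈ Finset.range (a + 1), f i) * ∏ i ∈ Finset.range (b + 1), f i ≤
      f 0 * ∏ i ∈ Finset.range (a + b + 1), f i := by
  induction a with
  | zero => simp
  | succ a ih =>
    rw [Finset.prod_range_succ, show a + 1 + b + 1 = (a + b + 1) + 1 by ring,
      Finset.prod_range_succ _ (a + b + 1)]
    have h1 : f (a + 1) ≤ f (a + b + 1) := hf (by omega)
    have h2 : 0 < ∏ i ∈ Finset.range (a + b + 1), f i := Finset.prod_pos fun i _ => hf0 i
    calc _ = ((∏ i ∈ Finset.range (a + 1), f i) * ∏ i ∈ Finset.range (b + 1), f i) *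
          f (a + 1) := by ring
      _ ≤ (f 0 * ∏ i ∈ Finset.range (a + b + 1), f i) * f (a + b + 1) :=
        mul_le_mul ih h1 (hf0 _).le (mul_pos (hf0 0) h2).le
      _ = _ := by ring

/-- The two extreme terms of the convolution of the products of `f` contribute `2 * ε / (n + 1) ^ 2`
relative to the next product, and all the others together at most half as much. -/
theorem convolution_prod_le {c ε : ℝ} (hc : 0 < c) (hf : Monotone f) (hf0 : 0 < f 0)
    (hf2 : ∀ n : ℕ, ((n : ℝ) + 1) ^ 2 * f 0 ≤ f n) (hε : c ≤ ε * f 0) (n : ℕ) :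
    ∑ i ∈ Finset.range (n + 1), (c * ∏ k ∈ Finset.range i, f k) *
        (c * ∏ k ∈ Finset.range (n - i), f k) ≤
      3 * ε / ((n : ℝ) + 1) ^ 2 * (c * ∏ k ∈ Finset.range (n + 1), f k) := by
  have hfp : ∀ n, 0 < f n := fun n => hf0.trans_le (hf (Nat.zero_le n))
  have hε0 : 0 < ε := pos_of_mul_pos_left (hc.trans_le hε) hf0.le
  have hP : ∀ n, 0 < ∏ k ∈ Finset.range n, f k := fun n => Finset.prod_pos fun i _ => hfp i
  rw [div_mul_eq_mul_div, le_div_iff₀ (by positivity)]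
  cases n with
  | zero =>
    simp
    nlinarith [mul_pos hc hc, mul_le_mul_of_nonneg_left hε hc.le]
  | succ m =>
    rw [Finset.sum_range_succ, Finset.sum_range_succ']
    have hmid : ∑ i ∈ Finset.range m, (c * ∏ k ∈ Finset.range (i + 1), f k) *
        (c * ∏ k ∈ Finset.range (m + 1 - (i + 1)), f k) ≤
        m * (c ^ 2 * (f 0 * ∏ k ∈ Finset.range m, f k)) := by
      calc _ ≤ ∑ i ∈ Finset.range m, c ^ 2 * (f 0 * ∏ k ∈ Finset.range m, f k) := by
            refine Finset.sum_le_sum fun i hi => ?_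
            obtain ⟨b, rfl⟩ := Nat.exists_eq_add_of_lt (Finset.mem_range.1 hi)
            rw [show i + b + 1 + 1 - (i + 1) = b + 1 by omega]
            have := mul_le_mul_of_nonneg_left (prod_mul_prod_le hf hfp i b) (sq_nonneg c)
            linarith
        _ = _ := by simp
    have hm := hf2 m
    have hm1 := hf2 (m + 1)
    rw [Finset.prod_range_succ _ (m + 1), Finset.prod_range_succ _ m]
    set P := ∏ k ∈ Finset.range m, f k with hPd
    have hPp : 0 < P := hP m
    simp only [Finset.range_zero, Finset.prod_empty, Nat.sub_zero, Nat.sub_self,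
      Finset.prod_range_succ _ m, ← hPd]
    push_cast at hm1 ⊢
    have hmm : (m : ℝ) * f 0 ≤ f m := by
      refine le_trans ?_ hm
      exact mul_le_mul_of_nonneg_right (by nlinarith [(Nat.cast_nonneg m : (0 : ℝ) ≤ m)]) hf0.le
    have hs : c * ((m : ℝ) + 1 + 1) ^ 2 ≤ ε * f (m + 1) := by
      calc c * ((m : ℝ) + 1 + 1) ^ 2 ≤ ε * f 0 * ((m : ℝ) + 1 + 1) ^ 2 := by gcongr
        _ = ε * (((m : ℝ) + 1 + 1) ^ 2 * f 0) := by ring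
        _ ≤ _ := by gcongr
    calc _ ≤ (m * (c ^ 2 * (f 0 * P)) + 2 * (c ^ 2 * (P * f m))) * ((m : ℝ) + 1 + 1) ^ 2 := by
          refine mul_le_mul_of_nonneg_right ?_ (by positivity)
          simp only [Nat.add_sub_add_right] at hmid ⊢
          linarith
      _ = (m * f 0 + 2 * f m) * (c * P) * (c * ((m : ℝ) + 1 + 1) ^ 2) := by ring
      _ ≤ (f m + 2 * f m) * (c * P) * (ε * f (m + 1)) := by
          have := hfp m
          gcongr
      _ = _ := by ring

/-- If the initial value `c` is small compared with `f 0`, and `f` grows at least quadratically,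
then the convolution term changes the solution `c * ∏ k < n, f k` of the linear recurrence only by
a convergent factor close to `1`. -/
theorem exists_tendsto_div_prod {G : ℕ → ℝ} {c ε : ℝ} (hc : 0 < c) (hf : Monotone f)
    (hf0 : 0 < f 0) (hf2 : ∀ n : ℕ, ((n : ℝ) + 1) ^ 2 * f 0 ≤ f n) (hε : c ≤ ε * f 0)
    (hε1 : ε ≤ 1 / 48) (hG0 : G 0 = c)
    (hG : ∀ n, G (n + 1) = ∑ i ∈ Finset.range (n + 1), G i * G (n - i) + f n * G n) :
    ∃ a, 1 ≤ a ∧ a ≤ 1 + 24 * ε ∧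
      Tendsto (fun n => G n / (c * ∏ k ∈ Finset.range n, f k)) atTop (nhds a) := by
  have hfp : ∀ n, 0 < f n := fun n => hf0.trans_le (hf (Nat.zero_le n))
  have hε0 : 0 < ε := pos_of_mul_pos_left (hc.trans_le hε) hf0.le
  set P : ℕ → ℝ := fun n => c * ∏ k ∈ Finset.range n, f k with hPd
  have hP : ∀ n, 0 < P n := fun n => mul_pos hc (Finset.prod_pos fun i _ => hfp i)
  have hPs : ∀ n, P (n + 1) = f n * P n := fun n => by
    simp only [hPd, Finset.prod_range_succ]; ring
  have hGp : ∀ n, 0 ≤ G n := by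
    intro n
    induction n using Nat.strong_induction_on with
    | _ n ih =>
      cases n with
      | zero => rw [hG0]; exact hc.le
      | succ n =>
        rw [hG]
        exact add_nonneg (Finset.sum_nonneg fun i hi =>
          mul_nonneg (ih _ (Finset.mem_range.1 hi)) (ih _ (by omega)))
          (mul_nonneg (hfp n).le (ih n (by omega)))
  have hmono : Monotone fun n => G n / P n := by
    refine monotone_nat_of_le_succ fun n => ?_
    rw [div_le_div_iff₀ (hP n) (hP _), hPs, hG]
    have : 0 ≤ ∑ i ∈ Finset.range (n + 1), G i * G (n - i) :=
      Finset.sum_nonneg fun i _ => mul_nonneg (hGp _) (hGp _)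
    nlinarith [mul_nonneg this (hP n).le]
  -- The partial sums of `1 / (k + 1) ^ 2` are bounded by the telescoping quantity `2 - 2 / (2n+1)`.
  have hb : ∀ n : ℕ, G n ≤ (1 + 12 * ε * (2 - 2 / (2 * (n : ℝ) + 1))) * P n := by
    intro n
    induction n using Nat.strong_induction_on with
    | _ n ih =>
      cases n with
      | zero => simp [hG0, hPd]
      | succ n =>
        -- As `24 * ε ≤ 1 / 2`, the bound implies `G k ≤ 2 * P k`, enough for the quadratic term.
        have h2 : ∀ k < n + 1, G k ≤ 2 * P k := by
          intro k hk
          refine (ih k hk).trans (mul_le_mul_of_nonneg_right ?_ (hP k).le)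
          have : 0 ≤ 2 / (2 * (k : ℝ) + 1) := by positivity
          nlinarith [mul_nonneg hε0.le this]
        have hconv : ∑ i ∈ Finset.range (n + 1), G i * G (n - i) ≤
            12 * ε / ((n : ℝ) + 1) ^ 2 * P (n + 1) := by
          calc _ ≤ ∑ i ∈ Finset.range (n + 1), 4 * (P i * P (n - i)) := by
                refine Finset.sum_le_sum fun i hi => ?_
                have := mul_le_mul (h2 i (Finset.mem_range.1 hi)) (h2 (n - i) (by omega))
                  (hGp _) (by linarith [hP i])
                linarith
            _ ≤ 4 * (3 * ε / ((n : ℝ) + 1) ^ 2 * P (n + 1)) := by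
                rw [← Finset.mul_sum]
                exact mul_le_mul_of_nonneg_left (convolution_prod_le hc hf hf0 hf2 hε n)
                  (by norm_num)
            _ = _ := by ring
        have hn := mul_le_mul_of_nonneg_left (ih n (by omega)) (hfp n).le
        rw [hG]
        have htel : 1 / ((n : ℝ) + 1) ^ 2 ≤
            2 / (2 * (n : ℝ) + 1) - 2 / (2 * ((n : ℝ) + 1) + 1) := by
          rw [div_sub_div _ _ (by positivity) (by positivity),
            div_le_div_iff₀ (by positivity) (by positivity)]
          nlinarith
        have htel' := mul_le_mul_of_nonneg_right
          (mul_le_mul_of_nonneg_left htel (by positivity : (0 : ℝ) ≤ 12 * ε)) (hP (n + 1)).le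
        push_cast
        rw [hPs] at hconv htel' ⊢
        have e : 12 * ε / ((n : ℝ) + 1) ^ 2 = 12 * ε * (1 / ((n : ℝ) + 1) ^ 2) := by ring
        rw [e] at hconv
        linarith
  have hb' : ∀ n, G n / P n ≤ 1 + 24 * ε := by
    intro n
    rw [div_le_iff₀ (hP n)]
    refine (hb n).trans (mul_le_mul_of_nonneg_right ?_ (hP n).le)
    have : 0 ≤ 2 / (2 * (n : ℝ) + 1) := by positivity
    nlinarith [mul_nonneg hε0.le this]
  have hbdd : BddAbove (Set.range fun n => G n / P n) := ⟨_, Set.forall_mem_range.2 hb'⟩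
  refine ⟨⨆ n, G n / P n, ?_, ciSup_le hb', tendsto_atTop_ciSup hmono hbdd⟩
  refine le_trans (le_of_eq ?_) (le_ciSup hbdd 0)
  simp [hG0, hPd, hc.ne']

end Recurrence

/-! ### The number of insertions -/

theorem bciInsertions_factor_pos {p k j : ℕ} (hp : 1 ≤ p) (hk : 1 ≤ k) :
    0 < 2 * ((2 * (p : ℝ) + 1) * k - 1 + 2 * j) := by
  have hp' : (1 : ℝ) ≤ p := by exact_mod_cast hp
  have hk' : (1 : ℝ) ≤ k := by exact_mod_cast hk
  have hj : (0 : ℝ) ≤ j := Nat.cast_nonneg j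
  nlinarith

theorem bciInsertions_pos {p k : ℕ} (hp : 1 ≤ p) (hk : 1 ≤ k) : 0 < bciInsertions p k :=
  div_pos (Finset.prod_pos fun _ _ => bciInsertions_factor_pos hp hk) (by positivity)

theorem bciInsertions_mono {p k l : ℕ} (hp : 1 ≤ p) (hk : 1 ≤ k) (hkl : k ≤ l) :
    bciInsertions p k ≤ bciInsertions p l := by
  refine div_le_div_of_nonneg_right ?_ (by positivity)
  refine Finset.prod_le_prod (fun _ _ => (bciInsertions_factor_pos hp hk).le) fun j _ => ?_
  gcongr

/-- The first two factors alone give quadratic growth. -/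
theorem sq_mul_bciInsertions_one_le {p k : ℕ} (hp : 2 ≤ p) (hk : 1 ≤ k) :
    (k : ℝ) ^ 2 * bciInsertions p 1 ≤ bciInsertions p k := by
  obtain ⟨q, rfl⟩ := Nat.exists_eq_add_of_le' hp
  rw [bciInsertions, bciInsertions, ← mul_div_assoc]
  refine div_le_div_of_nonneg_right ?_ (by positivity)
  rw [Finset.prod_range_succ', Finset.prod_range_succ', Finset.prod_range_succ',
    Finset.prod_range_succ']
  have hk' : (1 : ℝ) ≤ k := by exact_mod_cast hk
  have h1 : ∏ j ∈ Finset.range q,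
      2 * ((2 * ((q + 2 : ℕ) : ℝ) + 1) * (1 : ℕ) - 1 + 2 * ((j + 1 + 1 : ℕ) : ℝ)) ≤
      ∏ j ∈ Finset.range q,
      2 * ((2 * ((q + 2 : ℕ) : ℝ) + 1) * (k : ℝ) - 1 + 2 * ((j + 1 + 1 : ℕ) : ℝ)) := by
    refine Finset.prod_le_prod (fun _ _ => (bciInsertions_factor_pos (by omega) le_rfl).le)
      fun j _ => ?_
    push_cast
    gcongr
  have h0 : 0 < ∏ j ∈ Finset.range q,
      2 * ((2 * ((q + 2 : ℕ) : ℝ) + 1) * (1 : ℕ) - 1 + 2 * ((j + 1 + 1 : ℕ) : ℝ)) :=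
    Finset.prod_pos fun _ _ => bciInsertions_factor_pos (by omega) le_rfl
  set A := ∏ j ∈ Finset.range q,
    2 * ((2 * ((q + 2 : ℕ) : ℝ) + 1) * (1 : ℕ) - 1 + 2 * ((j + 1 + 1 : ℕ) : ℝ))
  set B := ∏ j ∈ Finset.range q,
    2 * ((2 * ((q + 2 : ℕ) : ℝ) + 1) * (k : ℝ) - 1 + 2 * ((j + 1 + 1 : ℕ) : ℝ))
  push_cast
  have hq : (0 : ℝ) ≤ q := Nat.cast_nonneg q
  set x : ℝ := 2 * ((q : ℝ) + 2) + 1 with hx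
  have hx5 : 5 ≤ x := by linarith
  calc _ = A * (4 * (x ^ 2 * (k : ℝ) ^ 2 - (k : ℝ) ^ 2)) := by ring
    _ ≤ B * (4 * (x ^ 2 * (k : ℝ) ^ 2 - 1)) := by
      have : 1 ≤ (k : ℝ) ^ 2 := by nlinarith
      have hx1 : 0 ≤ x ^ 2 - 1 := by nlinarith
      refine mul_le_mul h1 (by linarith) ?_ (h0.trans_le h1).le
      linarith [mul_nonneg (sq_nonneg (k : ℝ)) hx1]
    _ = _ := by ring

/-- Hence `catalan (p - 1)`, the initial value of the recurrence, is smaller than its first coefficient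
by the factor `4 ^ p * (2 * p - 1)`; this is what makes the limiting constant close to `1`. -/
theorem bciInsertions_one {p : ℕ} (hp : 1 ≤ p) :
    bciInsertions p 1 = 4 ^ p * (2 * (p : ℝ) - 1) * catalan (p - 1) := by
  obtain ⟨n, rfl⟩ := Nat.exists_eq_add_of_le' hp
  have h1 : ∏ j ∈ Finset.range (n + 1), 2 * ((2 * ((n + 1 : ℕ) : ℝ) + 1) * (1 : ℕ) - 1 + 2 * j) =
      4 ^ (n + 1) * ((n + 1).ascFactorial (n + 1) : ℝ) := by
    rw [Nat.ascFactorial_eq_prod_range]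
    push_cast
    rw [← Finset.card_range (n + 1), ← Finset.prod_const, Finset.card_range,
      ← Finset.prod_mul_distrib]
    refine Finset.prod_congr rfl fun j _ => ?_
    ring
  have h2 : (n + 1).ascFactorial (n + 1) = (n + 1)! * ((2 * n + 1) * catalan n) := by
    rw [Nat.ascFactorial_eq_factorial_mul_choose', show n + 1 + (n + 1) - 1 = 2 * n + 1 by omega]
    congr 1
    have h3 := Nat.add_one_mul_choose_eq (2 * n) n
    rw [← Nat.centralBinom_eq_two_mul_choose, ← succ_mul_catalan_eq_centralBinom] at h3
    refine Nat.eq_of_mul_eq_mul_left (Nat.succ_pos n) ?_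
    rw [Nat.succ_eq_add_one]
    linear_combination -h3
  rw [bciInsertions, h1, h2, Nat.add_sub_cancel]
  have : ((n + 1)! : ℝ) ≠ 0 := by positivity
  push_cast
  field_simp
  ring

/-! ### Asymptotics of the solution of the linear recurrence -/

/-- Euler's limit for the Gamma function, as an asymptotic equivalence. -/
theorem prod_range_add_isEquivalent {x : ℝ} (hx : 0 < 1 + x) :
    (fun n : ℕ => ∏ k ∈ Finset.range n, ((k : ℝ) + 1 + x)) ~[atTop]
      fun n : ℕ => 1 / Real.Gamma (1 + x) * (n ! * ((n : ℝ) + 1) ^ x) := by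
  have hG0 : 0 < Real.Gamma (1 + x) := Real.Gamma_pos_of_pos hx
  have hG := (tendsto_const_nhds (x := Real.Gamma (1 + x))).div
    (Real.GammaSeq_tendsto_Gamma (1 + x)) hG0.ne'
  have hr : Tendsto (fun n : ℕ => ((n : ℝ) / (n + 1)) ^ (1 + x)) atTop (nhds 1) := by
    have := (tendsto_natCast_div_add_atTop (1 : ℝ)).rpow_const (p := 1 + x) (Or.inl one_ne_zero)
    simpa using this
  have hq : Tendsto (fun n : ℕ => ((n : ℝ) / (n + (1 + x))) / ((n : ℝ) / (n + 1)))
      atTop (nhds (1 / 1)) :=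
    (tendsto_natCast_div_add_atTop (1 + x)).div (tendsto_natCast_div_add_atTop (1 : ℝ))
      one_ne_zero
  have hlim := (hG.mul hr).mul hq
  rw [div_self hG0.ne', one_mul, div_one, one_mul] at hlim
  rw [isEquivalent_iff_tendsto_one]
  · refine hlim.congr' ?_
    filter_upwards [eventually_ge_atTop 1] with n hn
    have hn' : (0 : ℝ) < n := by exact_mod_cast hn
    have hP : 0 < ∏ k ∈ Finset.range n, ((k : ℝ) + 1 + x) :=
      Finset.prod_pos fun k _ => by linarith [(Nat.cast_nonneg k : (0 : ℝ) ≤ k)]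
    have hP' : ∏ k ∈ Finset.range n, (1 + x + (k : ℝ)) =
        ∏ k ∈ Finset.range n, ((k : ℝ) + 1 + x) :=
      Finset.prod_congr rfl fun k _ => by ring
    have e1 : ((n : ℝ) + 1) ^ (1 + x) = (n + 1) * ((n : ℝ) + 1) ^ x := by
      rw [Real.rpow_add (by positivity), Real.rpow_one]
    simp only [Pi.div_apply, Real.GammaSeq]
    rw [Finset.prod_range_succ, hP', Real.div_rpow hn'.le (by positivity), e1]
    have h1 : 0 < (n : ℝ) ^ (1 + x) := by positivity
    have h2 : 0 < ((n : ℝ) + 1) ^ x := by positivity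
    have h3 : (0 : ℝ) < n + (1 + x) := by positivity
    have h4 : 1 + x + (n : ℝ) = n + (1 + x) := by ring
    rw [h4]
    field_simp
  · refine Eventually.of_forall fun n => ?_
    have h2 : 0 < ((n : ℝ) + 1) ^ x := by positivity
    positivity

/-- Up to the factor `bciBeta p`, the coefficient is a product of `p` linear factors in `k`, each of
which contributes one Gamma value to the asymptotics. -/
theorem bciInsertions_eq (p k : ℕ) : bciInsertions p (k + 1) = bciBeta p *
    ∏ j ∈ Finset.range p, ((k : ℝ) + 1 + (2 * (j : ℝ) - 1) / (2 * (p : ℝ) + 1)) := by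
  have h0 : (2 * (p : ℝ) + 1) ≠ 0 := by positivity
  rw [bciInsertions, bciBeta, div_mul_eq_mul_div]
  congr 1
  have h1 : (4 * (p : ℝ) + 2) ^ p = ∏ _j ∈ Finset.range p, (4 * (p : ℝ) + 2) := by simp
  rw [h1, ← Finset.prod_mul_distrib]
  refine Finset.prod_congr rfl fun j _ => ?_
  push_cast
  field_simp
  ring

theorem sum_range_div_eq_bciGamma (p : ℕ) :
    ∑ j ∈ Finset.range p, (2 * (j : ℝ) - 1) / (2 * (p : ℝ) + 1) = bciGamma p := by
  have h : ∀ q : ℕ, ∑ j ∈ Finset.range q, (2 * (j : ℝ) - 1) = q * (q - 2) := by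
    intro q
    induction q with
    | zero => simp
    | succ q ih => rw [Finset.sum_range_succ, ih]; push_cast; ring
  rw [← Finset.sum_div, h, bciGamma]

/-- The constant with the product indexed by `j = p - k`, the order of the factors in
`bciInsertions_eq`. -/
theorem bciB_eq (p : ℕ) : bciB p = catalan (p - 1) * ∏ j ∈ Finset.range p,
    1 / Real.Gamma (1 + (2 * (j : ℝ) - 1) / (2 * (p : ℝ) + 1)) := by
  rw [bciB]
  congr 1
  refine Finset.prod_nbij' (fun k => p - k) (fun j => p - j) ?_ ?_ ?_ ?_ ?_
  · intro k hk; simp only [Finset.mem_Icc, Finset.mem_range] at hk ⊢; omega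
  · intro k hk; simp only [Finset.mem_Icc, Finset.mem_range] at hk ⊢; omega
  · intro k hk; simp only [Finset.mem_Icc] at hk; omega
  · intro k hk; simp only [Finset.mem_range] at hk; omega
  · intro k hk
    simp only [Finset.mem_Icc] at hk
    rw [Nat.cast_sub hk.2]

theorem prod_bciInsertions_isEquivalent (p : ℕ) :
    (fun n : ℕ => (catalan (p - 1) : ℝ) * ∏ k ∈ Finset.range n, bciInsertions p (k + 1)) ~[atTop]
      fun n : ℕ => bciB p * bciBeta p ^ n * ((n : ℝ) + 1) ^ bciGamma p * (n ! : ℝ) ^ p := by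
  have hx : ∀ j ∈ Finset.range p, 0 < 1 + (2 * (j : ℝ) - 1) / (2 * (p : ℝ) + 1) := by
    intro j hj
    have : (0 : ℝ) < p := by exact_mod_cast (Nat.zero_le j).trans_lt (Finset.mem_range.1 hj)
    have e : 1 + (2 * (j : ℝ) - 1) / (2 * (p : ℝ) + 1) =
        (2 * (p : ℝ) + 2 * j) / (2 * (p : ℝ) + 1) := by
      field_simp
      ring
    rw [e]
    positivity
  have h := IsEquivalent.finsetProd (s := Finset.range p) fun j hj =>
    prod_range_add_isEquivalent (hx j hj)
  have h' := (IsEquivalent.refl (u := fun n : ℕ => (catalan (p - 1) : ℝ) * bciBeta p ^ n)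
    (l := atTop)).mul h
  convert h' using 1
  · funext n
    simp only [Pi.mul_apply, bciInsertions_eq, Finset.prod_mul_distrib, Finset.prod_const,
      Finset.card_range]
    rw [Finset.prod_comm]
    ring
  · funext n
    simp only [Pi.mul_apply, Finset.prod_mul_distrib, Finset.prod_const, Finset.card_range]
    rw [bciB_eq, ← sum_range_div_eq_bciGamma, Real.rpow_sum_of_pos (by positivity)]
    ring

/-! ### Asymptotics of the number of terms -/

theorem exists_bciCount_isEquivalent (p : ℕ) (hp : 2 ≤ p) : ∃ a : ℝ, 1 ≤ a ∧
    a ≤ 1 + 24 * (1 / (4 ^ p * (2 * (p : ℝ) - 1))) ∧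
    (fun n : ℕ => (bciCount p ((2 * p + 1) * n - 1) : ℝ)) ~[atTop]
      (fun n : ℕ => (a * bciB p) * bciBeta p ^ (n - 1) * (n : ℝ) ^ bciGamma p *
        ((n - 1)! : ℝ) ^ p) := by
  have hp1 : 1 ≤ p := by omega
  have hp' : (2 : ℝ) ≤ p := by exact_mod_cast hp
  have hc : (0 : ℝ) < catalan (p - 1) := by
    have h := succ_mul_catalan_eq_centralBinom (p - 1)
    have : catalan (p - 1) ≠ 0 := fun h0 =>
      Nat.centralBinom_ne_zero (p - 1) (by rw [← h, h0, mul_zero])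
    exact_mod_cast Nat.pos_of_ne_zero this
  have h4 : (4 : ℝ) ^ 2 ≤ 4 ^ p := pow_le_pow_right₀ (by norm_num) hp
  have hd : (48 : ℝ) ≤ 4 ^ p * (2 * (p : ℝ) - 1) := by nlinarith
  obtain ⟨a, ha1, ha2, ha⟩ := exists_tendsto_div_prod
    (f := fun n => bciInsertions p (n + 1)) (c := catalan (p - 1))
    (ε := 1 / (4 ^ p * (2 * (p : ℝ) - 1)))
    (G := fun n => (bciCount p ((2 * p + 1) * n + 2 * p) : ℝ)) hc
    (fun k l hkl => bciInsertions_mono hp1 (by omega) (by omega))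
    (bciInsertions_pos hp1 (by omega))
    (fun n => by simpa using sq_mul_bciInsertions_one_le (k := n + 1) hp (by omega))
    (by
      simp only [zero_add, bciInsertions_one hp1]
      rw [one_div, inv_mul_cancel_left₀ (by linarith)])
    (one_div_le_one_div_of_le (by norm_num) hd)
    (by simp [bciCount_two_mul hp1])
    (bciCount_recurrence hp1)
  refine ⟨a, ha1, ha2, ?_⟩
  have hP : ∀ n, (catalan (p - 1) : ℝ) * ∏ k ∈ Finset.range n, bciInsertions p (k + 1) ≠ 0 :=
    fun n => (mul_pos hc (Finset.prod_pos fun k _ => bciInsertions_pos hp1 (by omega))).ne'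
  have h1 : (fun n : ℕ => (bciCount p ((2 * p + 1) * n + 2 * p) : ℝ)) ~[atTop]
      fun n => a * ((catalan (p - 1) : ℝ) * ∏ k ∈ Finset.range n, bciInsertions p (k + 1)) := by
    have ha0 : a ≠ 0 := by linarith
    rw [isEquivalent_iff_tendsto_one (Eventually.of_forall fun n => mul_ne_zero ha0 (hP n))]
    have := ha.div_const a
    rw [div_self ha0] at this
    refine this.congr fun n => ?_
    rw [Pi.div_apply, div_div, mul_comm a]
  have h2 := h1.trans ((IsEquivalent.refl (u := fun _ : ℕ => a)).mul
    (prod_bciInsertions_isEquivalent p))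
  refine IsEquivalent.congr_left (IsEquivalent.congr_right
    (h2.comp_tendsto (tendsto_sub_atTop_nat 1)) ?_) ?_
  · filter_upwards [eventually_ge_atTop 1] with n hn
    obtain ⟨m, rfl⟩ := Nat.exists_eq_add_of_le' hn
    simp only [Function.comp_apply, Pi.mul_apply, Nat.add_sub_cancel]
    push_cast
    ring
  · filter_upwards [eventually_ge_atTop 1] with n hn
    obtain ⟨m, rfl⟩ := Nat.exists_eq_add_of_le' hn
    simp only [Function.comp_apply, Nat.add_sub_cancel]
    congr 2

theorem mainTheorem1 :
    ∃ a : ℕ → ℝ,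
      (∀ p : ℕ, 2 ≤ p →
        0 < a p ∧
        (fun n : ℕ => (bciCount p ((2 * p + 1) * n - 1) : ℝ)) ~[atTop]
          (fun n : ℕ => (a p * bciB p) * bciBeta p ^ (n - 1) * (n : ℝ) ^ bciGamma p *
            ((n - 1)! : ℝ) ^ p)) ∧
      (fun p : ℕ => a p - 1) =O[atTop] (fun p : ℕ => 1 / ((p : ℝ) * Real.exp (p : ℝ))) := by
  choose! a ha1 ha2 ha using exists_bciCount_isEquivalent
  refine ⟨a, fun p hp => ⟨by linarith [ha1 p hp], ha p hp⟩, IsBigO.of_bound 24 ?_⟩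
  filter_upwards [eventually_ge_atTop 2] with p hp
  have hp' : (2 : ℝ) ≤ p := by exact_mod_cast hp
  have he : Real.exp p ≤ 4 ^ p := by
    rw [← Real.exp_one_pow]
    exact pow_le_pow_left₀ (Real.exp_pos 1).le (by linarith [Real.exp_one_lt_d9]) p
  rw [Real.norm_of_nonneg (by linarith [ha1 p hp]), Real.norm_of_nonneg (by positivity)]
  have h1 : 1 / (4 ^ p * (2 * (p : ℝ) - 1)) ≤ 1 / ((p : ℝ) * Real.exp p) := by
    refine one_div_le_one_div_of_le (by positivity) ?_
    rw [mul_comm]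
    exact mul_le_mul he (by linarith) (by linarith) (by positivity)
  linarith [ha2 p hp]
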